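/- **Proposition.** Let $d\ge 1$. For a unitary operator $U$ on $\mathbb C^d$ let $\mathcal C_{1,U}$ and $\mathcal C_{2,U}$ be the quantum channels from $A\cong\mathbb C^d$ to $B\otimes C\cong\mathbb C^d\otimes\mathbb C^d$ given by $$\mathcal C_{1,U}(\rho)=U\rho U^\dagger\otimes \frac{I}{d},\qquad \mathcal C_{2,U}(\rho)=\frac{I}{d}\otimes U\rho U^\dagger .$$ For two channels $\mathcal C_1,\mathcal C_2$ with the same input and the same output, the fidelity divergence is $$\partial F(\mathcal C_1,\mathcal C_2)=\inf_R\ \inf_{\rho_1,\rho_2}\frac{F\big[(\mathcal C_1\otimes\mathcal I_R)(\rho_1),(\mathcal C_2\otimes\mathcal I_R)(\rho_2)\big]}{F(\rho_1,\rho_2)},$$ where $R$ ranges over all finite-dimensional reference systems, $\rho_1,\rho_2$ range over the pairs of joint density matrices of the channel input and $R$ with $F(\rho_1,\rho_2)\neq0$, and $F(\rho,\sigma)=\big(\operatorname{Tr}\sqrt{\sqrt\rho\,\sigma\sqrt\rho}\big)^2$. A sequential strategy with $N\ge1$ queries to a channel prepares a joint state of the channel input and a finite-dimensional reference system, applies the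 channel $N$ times with arbitrary quantum channels (completely positive trace-preserving maps) acting on the output and on the reference system, whose dimension may change, between consecutive uses, and finally measures the output and the reference system with a two-outcome POVM $\{P_1,P_2\}$. If $\rho^{(N)}_x$ denotes the state before the measurement when the channel is $\mathcal C_x$, its error probability in distinguishing $\mathcal C_1$ from $\mathcal C_2$ is $\frac12\operatorname{Tr}[P_2\rho^{(N)}_1]+\frac12\operatorname{Tr}[P_1\rho^{(N)}_2]$, and $p_{\rm err}^{\rm seq}(\mathcal C_1,\mathcal C_2;N)$ is the infimum of this over all sequential strategies with $N$ queries. The worst-case error of a strategy in identifying the causal intermediary is the supremum, over all pairs of unitaries $U,V$, of its error probability in distinguishing $\mathcal C_{1,U}$ from $\mathcal C_{2,V}$. The rate of a sequence of error probabilities $p(N)$ is $R=-\liminf_{N\to\infty}\frac1N\log_2 p(N)$. Then: 1. For every unitary $U$, $\ \partial F(\mathcal C_{1,U},\mathcal C_{2,U})=\dfrac1{d^2}$. 2. For every unitary $U$ and every $N\ge1$, every sequential strategy with $N$ queries has error probability at least $\dfrac1{4d^{2N}}$ in distinguishing $\mathcal C_{1,U}$ from $\mathcal C_{2,U}$; hence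 $p_{\rm err}^{\rm seq}(\mathcal C_{1,U},\mathcal C_{2,U};N)\ge \dfrac1{4d^{2N}}$. 3. For every $N\ge1$, every sequential strategy with $N$ queries identifies the causal intermediary with worst-case error at least $\dfrac1{4d^{2N}}$, and the same bound holds for the infimum of the worst-case error over all such strategies. 4. The rate of the worst-case error is at most $2\log_2 d$, both for every choice of one sequential strategy for each $N$ and for the infimum of the worst-case error over all sequential strategies with $N$ queries. -/

import Mathlib

open scoped Kronecker MatrixOrder ComplexOrder Matrix

noncomputable section

namespace CausalId

/-- A density matrix: positive semidefinite with unit trace. -/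
def IsDensity {A : Type} [Fintype A] (ρ : Matrix A A ℂ) : Prop :=
  ρ.PosSemidef ∧ ρ.trace = 1

/-- `(Φ ⊗ id_R)(ρ)`: the map `Φ` acts on the block `(⟨·, k| ρ |·, l⟩)` of `ρ` for all basis
vectors `k`, `l` of the reference system `R`. -/
def ampliate {A B : Type} (R : Type)
    (Φ : Matrix A A ℂ →ₗ[ℂ] Matrix B B ℂ) (ρ : Matrix (A × R) (A × R) ℂ) :
    Matrix (B × R) (B × R) ℂ :=
  Matrix.of fun i j => Φ (Matrix.of fun a a' => ρ (a, i.2) (a', j.2)) i.1 j.1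

/-- A quantum channel: a completely positive trace-preserving linear map. -/
def IsChannel {A B : Type} [Fintype A] [Fintype B]
    (Φ : Matrix A A ℂ →ₗ[ℂ] Matrix B B ℂ) : Prop :=
  (∀ (r : ℕ) (ρ : Matrix (A × Fin r) (A × Fin r) ℂ),
      ρ.PosSemidef → (ampliate (Fin r) Φ ρ).PosSemidef) ∧
    ∀ ρ : Matrix A A ℂ, (Φ ρ).trace = ρ.trace

/-- The (squared) Uhlmann fidelity `F(ρ, σ) = (Tr √(√ρ σ √ρ))²`. -/
def fidelity {A : Type} [Fintype A] [DecidableEq A] (ρ σ : Matrix A A ℂ) : ℝ :=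
  ((CFC.sqrt (CFC.sqrt ρ * σ * CFC.sqrt ρ)).trace.re) ^ 2

/-- The fidelity divergence of two channels: the infimum, over all finite-dimensional reference
systems and all pairs of joint states of nonzero fidelity, of the ratio between the fidelity of
the output states and the fidelity of the input states. -/
def fidelityDivergence {A B : Type} [Fintype A] [DecidableEq A] [Fintype B] [DecidableEq B]
    (C₁ C₂ : Matrix A A ℂ →ₗ[ℂ] Matrix B B ℂ) : ℝ :=
  sInf {x : ℝ | ∃ (r : ℕ) (ρ₁ ρ₂ : Matrix (A × Fin r) (A × Fin r) ℂ),
    IsDensity ρ₁ ∧ IsDensity ρ₂ ∧ fidelity ρ₁ ρ₂ ≠ 0 ∧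
    x = fidelity (ampliate (Fin r) C₁ ρ₁) (ampliate (Fin r) C₂ ρ₂) / fidelity ρ₁ ρ₂}

/-- A sequential strategy with `N ≥ 1` queries to a black box with input `A` and output `B`.
A joint state of the input and of a reference system is prepared; between the queries number
`t + 1` and `t + 2` an arbitrary channel acts on the output of the black box and on the
reference system, whose dimension `mem t` may change at each step; the output of the last
query (number `N`) is measured jointly with the reference system by the two-outcome POVM
`guess₁, guess₂`.  (Interventions with index `t ≥ N - 1` are never used.) -/
structure SequentialStrategy (A B : Type) [Fintype A] [Fintype B] [DecidableEq B] (N : ℕ) where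
  mem : ℕ → ℕ
  init : Matrix (A × Fin (mem 0)) (A × Fin (mem 0)) ℂ
  init_isDensity : IsDensity init
  step : ∀ t : ℕ, Matrix (B × Fin (mem t)) (B × Fin (mem t)) ℂ →ₗ[ℂ]
    Matrix (A × Fin (mem (t + 1))) (A × Fin (mem (t + 1))) ℂ
  step_isChannel : ∀ t : ℕ, IsChannel (step t)
  guess₁ : Matrix (B × Fin (mem (N - 1))) (B × Fin (mem (N - 1))) ℂ
  guess₂ : Matrix (B × Fin (mem (N - 1))) (B × Fin (mem (N - 1))) ℂ
  guess₁_posSemidef : guess₁.PosSemidef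
  guess₂_posSemidef : guess₂.PosSemidef
  guess_add : guess₁ + guess₂ = 1

namespace SequentialStrategy

variable {A B : Type} [Fintype A] [Fintype B] [DecidableEq B] {N : ℕ}

/-- The joint state right before query number `t + 1`, when the black box is `C`. -/
def stateBefore (S : SequentialStrategy A B N) (C : Matrix A A ℂ →ₗ[ℂ] Matrix B B ℂ) :
    (t : ℕ) → Matrix (A × Fin (S.mem t)) (A × Fin (S.mem t)) ℂ
  | 0 => S.init
  | t + 1 => S.step t (ampliate (Fin (S.mem t)) C (stateBefore S C t))

/-- The joint state right after the `N`-th query (for `N ≥ 1`), when the black box is `C`. -/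
def finalState (S : SequentialStrategy A B N) (C : Matrix A A ℂ →ₗ[ℂ] Matrix B B ℂ) :
    Matrix (B × Fin (S.mem (N - 1))) (B × Fin (S.mem (N - 1))) ℂ :=
  ampliate (Fin (S.mem (N - 1))) C (S.stateBefore C (N - 1))

/-- The error probability in distinguishing `C₁` from `C₂`, with equal prior probabilities:
`(Tr[P₂ ρ₁] + Tr[P₁ ρ₂]) / 2`. -/
def errorProb (S : SequentialStrategy A B N)
    (C₁ C₂ : Matrix A A ℂ →ₗ[ℂ] Matrix B B ℂ) : ℝ :=
  1 / 2 * (S.guess₂ * S.finalState C₁).trace.re +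
    1 / 2 * (S.guess₁ * S.finalState C₂).trace.re

end SequentialStrategy

/-- The minimum error probability in distinguishing `C₁` from `C₂` with `N` queries. -/
def seqErrorProb {A B : Type} [Fintype A] [Fintype B] [DecidableEq B]
    (C₁ C₂ : Matrix A A ℂ →ₗ[ℂ] Matrix B B ℂ) (N : ℕ) : ℝ :=
  ⨅ S : SequentialStrategy A B N, S.errorProb C₁ C₂

/-- The channel `ρ ↦ U ρ U† ⊗ I/d`: the first output is the causal intermediary. -/
def channel₁ (d : ℕ) (U : Matrix.unitaryGroup (Fin d) ℂ) :
    Matrix (Fin d) (Fin d) ℂ →ₗ[ℂ] Matrix (Fin d × Fin d) (Fin d × Fin d) ℂ where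
  toFun ρ := ((U : Matrix (Fin d) (Fin d) ℂ) * ρ * (U : Matrix (Fin d) (Fin d) ℂ)ᴴ) ⊗ₖ
    ((d : ℂ)⁻¹ • (1 : Matrix (Fin d) (Fin d) ℂ))
  map_add' ρ σ := by rw [mul_add, add_mul, Matrix.add_kronecker]
  map_smul' c ρ := by
    rw [Matrix.mul_smul, Matrix.smul_mul, Matrix.smul_kronecker, RingHom.id_apply]

/-- The channel `ρ ↦ I/d ⊗ U ρ U†`: the second output is the causal intermediary. -/
def channel₂ (d : ℕ) (U : Matrix.unitaryGroup (Fin d) ℂ) :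
    Matrix (Fin d) (Fin d) ℂ →ₗ[ℂ] Matrix (Fin d × Fin d) (Fin d × Fin d) ℂ where
  toFun ρ := ((d : ℂ)⁻¹ • (1 : Matrix (Fin d) (Fin d) ℂ)) ⊗ₖ
    ((U : Matrix (Fin d) (Fin d) ℂ) * ρ * (U : Matrix (Fin d) (Fin d) ℂ)ᴴ)
  map_add' ρ σ := by rw [mul_add, add_mul, Matrix.kronecker_add]
  map_smul' c ρ := by
    rw [Matrix.mul_smul, Matrix.smul_mul, Matrix.kronecker_smul, RingHom.id_apply]

/-- A strategy for identifying the causal intermediary of a `d`-dimensional system. -/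
abbrev IntermediaryStrategy (d N : ℕ) : Type :=
  SequentialStrategy (Fin d) (Fin d × Fin d) N

/-- The worst-case error probability of a strategy, over the unknown unitary gates. -/
def worstCaseError {d N : ℕ} (S : IntermediaryStrategy d N) : ℝ :=
  ⨆ p : Matrix.unitaryGroup (Fin d) ℂ × Matrix.unitaryGroup (Fin d) ℂ,
    S.errorProb (channel₁ d p.1) (channel₂ d p.2)

/-- The minimum over the sequential strategies with `N` queries of the worst-case error
probability in identifying the causal intermediary. -/
def intermediaryError (d N : ℕ) : ℝ :=
  ⨅ S : IntermediaryStrategy d N, worstCaseError S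

/-- The discrimination rate of a sequence of error probabilities `p N ≈ 2 ^ (-R N)`, that is,
`R = - liminf (log₂ p N) / N`. -/
def discriminationRate (p : ℕ → ℝ) : EReal :=
  Filter.limsup (fun N : ℕ => ((-Real.logb 2 (p N) / N : ℝ) : EReal)) Filter.atTop

end CausalId

end

/-! Two states are compared through positive block matrices `fromBlocks ρ X Y σ`. The root fidelity
is the largest value of `Re Tr X` over such completions (`exists_trace_eq_rootFidelity`,
`re_trace_le_rootFidelity`), so a lower bound on fidelity only requires following one off-diagonal
block.

A query sends a completion of the inputs to one of the outputs, with `Tr X` divided by exactly `d`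
(`exists_fromBlocks_ampliate`): conjugation by `U`, then a Schur product with a positive mask of
Kronecker deltas. This gives the lower bound `1/d²` on the divergence; the maximally entangled state
attains it.

In a sequential strategy both runs start from the same state, so `X` may be that state, with trace
one. Intermediate channels act blockwise, preserving positivity and `Tr X`, and after `N` queries
`Tr X = d⁻ᴺ`. By `sq_re_trace_le_error` the error is at least `(Re Tr X)²/4`. The worst-case bound
follows by taking both gates equal to the identity, and the rate bound by taking logarithms. -/

namespace Matrix

/-! ### Contractions, polar decomposition and positive block matrices -/

variable {l m n : Type*} [Fintype l] [Fintype m] [Fintype n]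

theorem PosSemidef.trace_mul_nonneg [DecidableEq n] {P Q : Matrix n n ℂ}
    (hP : P.PosSemidef) (hQ : Q.PosSemidef) : 0 ≤ (P * Q).trace := by
  obtain ⟨B, rfl⟩ := CStarAlgebra.nonneg_iff_eq_star_mul_self.mp hP.nonneg
  rw [star_eq_conjTranspose, mul_assoc, trace_mul_comm]
  exact (hQ.mul_mul_conjTranspose_same B).trace_nonneg

theorem PosSemidef.of_mul_self_eq {P : Matrix n n ℂ} (hP : P.IsHermitian) (h : P * P = P) :
    P.PosSemidef := by
  have := posSemidef_conjTranspose_mul_self P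
  rwa [hP.eq, h] at this

/-- Polar decomposition, with a contraction in place of a partial isometry. -/
theorem exists_polar [DecidableEq n] (Z : Matrix m n ℂ) :
    ∃ V : Matrix m n ℂ, (1 - Vᴴ * V).PosSemidef ∧
      V * CFC.sqrt (Zᴴ * Z) = Z ∧ Vᴴ * Z = CFC.sqrt (Zᴴ * Z) := by
  set S := CFC.sqrt (Zᴴ * Z) with hSdef
  have hS0 : 0 ≤ S := CFC.sqrt_nonneg _
  have hS : S * S = Zᴴ * Z :=
    CFC.sqrt_mul_sqrt_self _ (posSemidef_conjTranspose_mul_self Z).nonneg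
  have hSh : Sᴴ = S := (nonneg_iff_posSemidef.mp hS0).isHermitian
  have hsa : IsSelfAdjoint S := hSh
  have hc : ∀ f : ℝ → ℝ, ContinuousOn f (spectrum ℝ S) := fun f =>
    S.finite_real_spectrum.continuousOn f
  -- Since `0⁻¹ = 0`, this is the pseudo-inverse of `S`, and `G * S` is the projection onto its
  -- support. The spectrum is finite, so continuity is automatic.
  set G := cfc (fun x : ℝ => x⁻¹) S with hG
  have hGh : Gᴴ = G := cfc_predicate (R := ℝ) (fun x : ℝ => x⁻¹) S
  have hid : cfc (fun x : ℝ => x) S = S := cfc_id' ℝ S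
  have hcomm : S * G = G * S := by
    conv_lhs => rw [← hid, hG, ← cfc_mul _ _ S (hc _) (hc _)]
    conv_rhs => rw [hG]; arg 2; rw [← hid]
    rw [← cfc_mul _ _ S (hc _) (hc _)]
    simp only [mul_comm]
  have hSGS : S * (G * S) = S := by
    have h1 : G * S = cfc (fun x : ℝ => x⁻¹ * x) S := by
      rw [cfc_mul _ _ S (hc _) (hc _), hid]
    have h2 : S * (G * S) = cfc (fun x : ℝ => x * (x⁻¹ * x)) S := by
      rw [cfc_mul _ _ S (hc _) (hc _), hid, h1]
    rw [h2]
    conv_rhs => rw [← hid]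
    congr 1
    funext x
    by_cases hx : x = 0 <;> simp [hx]
  have hp : (G * S) * (G * S) = G * S := by rw [mul_assoc, hSGS]
  have hph : (G * S)ᴴ = G * S := by rw [conjTranspose_mul, hGh, hSh, hcomm]
  have hGSS : G * (S * S) = S := by rw [← mul_assoc, ← hcomm, mul_assoc, hSGS]
  refine ⟨Z * G, ?_, ?_, ?_⟩
  · have : (Z * G)ᴴ * (Z * G) = G * S := by
      rw [conjTranspose_mul, hGh, Matrix.mul_assoc, ← Matrix.mul_assoc Zᴴ, ← hS, mul_assoc S S G,
        hcomm, hSGS]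
    rw [this]
    refine PosSemidef.of_mul_self_eq ?_ ?_
    · rw [IsHermitian, conjTranspose_sub, hph, conjTranspose_one]
    · rw [mul_sub, sub_mul _ _ (G * S), hp]; simp
  -- `Z` vanishes on the kernel of `S`, because `Zᴴ * Z = S * S`.
  · have h0 : (Z * (1 - G * S))ᴴ * (Z * (1 - G * S)) = 0 := by
      have : S * (1 - G * S) = 0 := by rw [mul_sub, hSGS, mul_one, sub_self]
      rw [conjTranspose_mul, Matrix.mul_assoc, ← Matrix.mul_assoc Zᴴ, ← hS, mul_assoc S S, this]
      simp
    rw [conjTranspose_mul_self_eq_zero, Matrix.mul_sub, Matrix.mul_one, sub_eq_zero] at h0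
    rw [Matrix.mul_assoc, ← h0]
  · rw [conjTranspose_mul, hGh, Matrix.mul_assoc, ← hS, hGSS]

theorem posSemidef_fromBlocks_one [DecidableEq m] [DecidableEq n] {K : Matrix m n ℂ} :
    (fromBlocks 1 K Kᴴ 1).PosSemidef ↔ (1 - Kᴴ * K).PosSemidef := by
  let _ : Invertible (1 : Matrix m m ℂ) := invertibleOne
  rw [PosDef.fromBlocks₁₁ K 1 PosDef.one]; simp

/-- Both conditions are Schur complements of the same block matrix with unit diagonal blocks. -/
theorem posSemidef_one_sub_self_mul_conjTranspose [DecidableEq m] [DecidableEq n]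
    {K : Matrix m n ℂ} (h : (1 - Kᴴ * K).PosSemidef) : (1 - K * Kᴴ).PosSemidef := by
  let _ : Invertible (1 : Matrix n n ℂ) := invertibleOne
  rw [← posSemidef_fromBlocks_one, PosDef.fromBlocks₂₂ 1 K PosDef.one] at h
  simpa using h

theorem posSemidef_one_sub_mul [DecidableEq m] [DecidableEq n]
    {K : Matrix l m ℂ} {L : Matrix m n ℂ}
    (hK : (1 - Kᴴ * K).PosSemidef) (hL : (1 - Lᴴ * L).PosSemidef) :
    (1 - (K * L)ᴴ * (K * L)).PosSemidef := by
  convert hL.add (hK.conjTranspose_mul_mul_same L) using 1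
  rw [conjTranspose_mul, Matrix.mul_sub, Matrix.mul_one, Matrix.sub_mul]
  simp only [Matrix.mul_assoc]
  abel

/-- Adding `1 - Kᴴ * K ≥ 0` to `(1 - K)ᴴ * (1 - K) ≥ 0` gives `2 - K - Kᴴ ≥ 0`, which is then paired
with `H`. -/
theorem re_trace_contraction_mul_le [DecidableEq n] {K H : Matrix n n ℂ}
    (hK : (1 - Kᴴ * K).PosSemidef) (hH : H.PosSemidef) : (K * H).trace.re ≤ H.trace.re := by
  have h1 := (Complex.le_def.mp (hK.trace_mul_nonneg hH)).1
  have h2 := (Complex.le_def.mp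
    ((posSemidef_conjTranspose_mul_self (1 - K)).trace_mul_nonneg hH)).1
  have h3 : (Kᴴ * H).trace.re = (K * H).trace.re := by
    rw [← Complex.conj_re, starRingEnd_apply, ← trace_conjTranspose,
      conjTranspose_mul, hH.isHermitian.eq, conjTranspose_conjTranspose, trace_mul_comm]
  simp only [conjTranspose_sub, conjTranspose_one, sub_mul, mul_sub, one_mul, mul_one, trace_sub,
    Complex.sub_re, Complex.zero_re] at h1 h2
  linarith

theorem PosSemidef.fromBlocks_smul_add {ρ X Y σ : Matrix n n ℂ}
    [DecidableEq n] (h : (fromBlocks ρ X Y σ).PosSemidef) (a b : ℝ) :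
    ((a ^ 2 : ℂ) • ρ + (a * b : ℂ) • (X + Y) + (b ^ 2 : ℂ) • σ).PosSemidef := by
  convert h.mul_mul_conjTranspose_same
    (fromCols ((a : ℂ) • (1 : Matrix n n ℂ)) ((b : ℂ) • (1 : Matrix n n ℂ))) using 1
  rw [conjTranspose_fromCols_eq_fromRows_conjTranspose, fromCols_mul_fromBlocks,
    fromCols_mul_fromRows]
  simp only [conjTranspose_smul, conjTranspose_one, Matrix.smul_mul, Matrix.mul_smul,
    Matrix.one_mul, Matrix.mul_one, smul_add, smul_smul, Complex.star_def, Complex.conj_ofReal]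
  rw [pow_two, pow_two, mul_comm (b : ℂ) a]
  abel

theorem PosSemidef.fromBlocks_conj [DecidableEq m] {ρ X Y σ : Matrix n n ℂ}
    (h : (fromBlocks ρ X Y σ).PosSemidef) (V W : Matrix m n ℂ) :
    (fromBlocks (V * ρ * Vᴴ) (V * X * Wᴴ) (W * Y * Vᴴ) (W * σ * Wᴴ)).PosSemidef := by
  convert h.mul_mul_conjTranspose_same (fromBlocks V 0 0 W) using 1
  simp [fromBlocks_conjTranspose, fromBlocks_multiply]

omit [Fintype n] in
theorem PosSemidef.fromBlocks_diag {ρ X Y σ : Matrix n n ℂ}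
    (h : (fromBlocks ρ X Y σ).PosSemidef) : ρ.PosSemidef ∧ σ.PosSemidef :=
  ⟨h.submatrix Sum.inl, h.submatrix Sum.inr⟩

omit [Fintype n] in
theorem PosSemidef.fromBlocks_offDiag {ρ X Y σ : Matrix n n ℂ}
    (h : (fromBlocks ρ X Y σ).PosSemidef) : Xᴴ = Y :=
  (isHermitian_fromBlocks_iff.mp h.isHermitian).2.1

end Matrix

/-! ### Fidelity and measurement errors from off-diagonal blocks -/

namespace CausalId

open Matrix

variable {A B : Type} [Fintype A] [DecidableEq A] [Fintype B] [DecidableEq B]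

/-- The square root `Tr √(√ρ σ √ρ)` of the fidelity. -/
noncomputable def rootFidelity (ρ σ : Matrix A A ℂ) : ℝ :=
  (CFC.sqrt (CFC.sqrt ρ * σ * CFC.sqrt ρ)).trace.re

theorem rootFidelity_nonneg (ρ σ : Matrix A A ℂ) : 0 ≤ rootFidelity ρ σ :=
  (Complex.le_def.mp (CFC.sqrt_nonneg
    (CFC.sqrt ρ * σ * CFC.sqrt ρ)).posSemidef.trace_nonneg).1

theorem fidelity_eq_sq (ρ σ : Matrix A A ℂ) : fidelity ρ σ = rootFidelity ρ σ ^ 2 := rfl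

theorem sqrt_mul_mul_sqrt (ρ : Matrix A A ℂ) {σ : Matrix A A ℂ} (hσ : σ.PosSemidef) :
    CFC.sqrt ρ * σ * CFC.sqrt ρ =
      (CFC.sqrt σ * CFC.sqrt ρ)ᴴ * (CFC.sqrt σ * CFC.sqrt ρ) := by
  have h1 := (CFC.sqrt_nonneg ρ).posSemidef.isHermitian.eq
  have h2 := (CFC.sqrt_nonneg σ).posSemidef.isHermitian.eq
  rw [conjTranspose_mul, h1, h2]
  conv_lhs => rw [← CFC.sqrt_mul_sqrt_self σ hσ.nonneg]
  simp only [mul_assoc]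

/-- The root fidelity is attained as the trace of an off-diagonal block. -/
theorem exists_trace_eq_rootFidelity {ρ σ : Matrix A A ℂ}
    (hρ : ρ.PosSemidef) (hσ : σ.PosSemidef) :
    ∃ X Y : Matrix A A ℂ, (fromBlocks ρ X Y σ).PosSemidef ∧
      X.trace.re = rootFidelity ρ σ := by
  obtain ⟨V, hV, -, hVT⟩ := exists_polar (CFC.sqrt σ * CFC.sqrt ρ)
  have h1 := (CFC.sqrt_nonneg ρ).posSemidef.isHermitian.eq
  have h2 := (CFC.sqrt_nonneg σ).posSemidef.isHermitian.eq
  have hV' := posSemidef_one_sub_self_mul_conjTranspose hV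
  -- A contraction completes the identity blocks; conjugating by `√ρ ⊕ √σ` turns the diagonal into
  -- `ρ`, `σ` and the corner into `√ρ Vᴴ √σ`.
  have hb : (fromBlocks 1 Vᴴ V 1).PosSemidef := by
    have := posSemidef_fromBlocks_one (K := Vᴴ)
    rw [conjTranspose_conjTranspose] at this
    exact this.mpr hV'
  have := hb.fromBlocks_conj (CFC.sqrt ρ) (CFC.sqrt σ)
  rw [mul_one, mul_one, h1, h2, CFC.sqrt_mul_sqrt_self ρ hρ.nonneg,
    CFC.sqrt_mul_sqrt_self σ hσ.nonneg] at this
  refine ⟨_, _, this, ?_⟩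
  rw [rootFidelity, sqrt_mul_mul_sqrt ρ hσ, ← hVT, mul_assoc, trace_mul_comm, mul_assoc]

/-- The trace of an off-diagonal block is bounded by the root fidelity of the diagonal blocks. -/
theorem re_trace_le_rootFidelity {ρ σ X Y : Matrix A A ℂ}
    (h : (fromBlocks ρ X Y σ).PosSemidef) : X.trace.re ≤ rootFidelity ρ σ := by
  have hσ := h.fromBlocks_diag.2
  obtain ⟨Z, hZ⟩ := CStarAlgebra.nonneg_iff_eq_star_mul_self.mp h.nonneg
  rw [star_eq_conjTranspose, ← fromCols_toCols Z,
    conjTranspose_fromCols_eq_fromRows_conjTranspose, fromRows_mul_fromCols,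
    fromBlocks_inj] at hZ
  obtain ⟨h1, h2, -, h4⟩ := hZ
  -- With the Gram factor split into columns `V√ρ` and `W√σ`, the corner is `X = √ρ Vᴴ W √σ`. By
  -- cyclicity its trace is that of the contraction `Vᴴ W K` times `√(√ρ σ √ρ)`.
  obtain ⟨V, hV, hV1, -⟩ := exists_polar Z.toCols₁
  obtain ⟨W, hW, hW1, -⟩ := exists_polar Z.toCols₂
  rw [← h1] at hV1
  rw [← h4] at hW1
  obtain ⟨K, hK, hK1, -⟩ := exists_polar (CFC.sqrt σ * CFC.sqrt ρ)
  rw [← sqrt_mul_mul_sqrt ρ hσ] at hK1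
  have hV' : (1 - Vᴴᴴ * Vᴴ).PosSemidef := by
    rw [conjTranspose_conjTranspose]; exact posSemidef_one_sub_self_mul_conjTranspose hV
  have hc := posSemidef_one_sub_mul (posSemidef_one_sub_mul hV' hW) hK
  have := re_trace_contraction_mul_le hc
    (CFC.sqrt_nonneg (CFC.sqrt ρ * σ * CFC.sqrt ρ)).posSemidef
  rw [mul_assoc, hK1] at this
  convert this using 2
  rw [h2, ← hV1, ← hW1, conjTranspose_mul, (CFC.sqrt_nonneg ρ).posSemidef.isHermitian.eq,
    Matrix.mul_assoc, trace_mul_comm]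
  · simp only [Matrix.mul_assoc]
  · rfl

/-- The success probabilities of a measurement are limited by an off-diagonal block. -/
theorem sq_re_trace_le_error {ρ σ X Y P Q : Matrix A A ℂ}
    (h : (fromBlocks ρ X Y σ).PosSemidef) (hρ : ρ.trace = 1) (hσ : σ.trace = 1)
    (hP : P.PosSemidef) (hQ : Q.PosSemidef) (hPQ : P + Q = 1) :
    X.trace.re ^ 2 / 4 ≤ 1 / 2 * (Q * ρ).trace.re + 1 / 2 * (P * σ).trace.re := by
  have hY : Y.trace.re = X.trace.re := by
    rw [← h.fromBlocks_offDiag, trace_conjTranspose]; simp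
  obtain rfl : P = 1 - Q := eq_sub_of_add_eq hPQ
  set s : ℝ := -X.trace.re / 2
  have h1 := (Complex.le_def.mp (hP.trace_mul_nonneg (h.fromBlocks_smul_add s 1))).1
  have h2 := (Complex.le_def.mp (hQ.trace_mul_nonneg (h.fromBlocks_smul_add 1 s))).1
  have h3 := (Complex.le_def.mp (hP.trace_mul_nonneg h.fromBlocks_diag.2)).1
  have h4 := (Complex.le_def.mp (hQ.trace_mul_nonneg h.fromBlocks_diag.1)).1
  simp only [mul_add, sub_mul, one_mul, Matrix.mul_smul, trace_add, trace_sub, trace_smul, hρ, hσ,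
    smul_eq_mul, Complex.add_re, Complex.sub_re, Complex.zero_re, ← Complex.ofReal_pow,
    Complex.re_ofReal_mul, ← Complex.ofReal_mul, Complex.one_re] at *
  have hs : X.trace.re = -2 * s := by simp only [s]; ring
  rw [hY] at h1
  rw [hs] at h1 ⊢
  nlinarith [mul_nonneg (sq_nonneg s) h4, mul_nonneg (sq_nonneg s) h3]

/-! ### Action of channels on block matrices -/

section Channels

variable {A B : Type}

theorem trace_ampliate [Fintype A] [Fintype B] {R : Type} [Fintype R]
    {Φ : Matrix A A ℂ →ₗ[ℂ] Matrix B B ℂ} (hΦ : ∀ ρ, (Φ ρ).trace = ρ.trace)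
    (ρ : Matrix (A × R) (A × R) ℂ) : (ampliate R Φ ρ).trace = ρ.trace := by
  rw [Matrix.trace, Matrix.trace, Fintype.sum_prod_type_right, Fintype.sum_prod_type_right]
  exact Finset.sum_congr rfl fun r _ => hΦ (Matrix.of fun a a' => ρ (a, r) (a', r))

/-- Completely positive maps act entrywise on positive two-by-two block matrices. -/
theorem IsChannel.posSemidef_fromBlocks [Fintype A] [Fintype B]
    {Φ : Matrix A A ℂ →ₗ[ℂ] Matrix B B ℂ} (hΦ : IsChannel Φ)
    {ρ X Y σ : Matrix A A ℂ} (h : (fromBlocks ρ X Y σ).PosSemidef) :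
    (fromBlocks (Φ ρ) (Φ X) (Φ Y) (Φ σ)).PosSemidef := by
  -- A two-by-two block matrix is a joint matrix with a qubit reference, so complete positivity at
  -- `r = 2` suffices.
  let e : A × Fin 2 → A ⊕ A := fun x => if x.2 = 0 then Sum.inl x.1 else Sum.inr x.1
  let f : B ⊕ B → B × Fin 2 := Sum.elim (fun b => (b, 0)) fun b => (b, 1)
  convert (hΦ.1 2 _ (h.submatrix e)).submatrix f using 1
  ext (i | i) (j | j) <;> simp [ampliate, e, f] <;> rfl

end Channels

/-! ### Effect of one query -/

section Intermediary

variable {d : ℕ}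

theorem kronecker_one_conj_apply {R : Type} [Fintype R] [DecidableEq R]
    (U : Matrix (Fin d) (Fin d) ℂ) (ρ : Matrix (Fin d × R) (Fin d × R) ℂ)
    (b b' : Fin d) (r r' : R) :
    ((U ⊗ₖ (1 : Matrix R R ℂ)) * ρ * (U ⊗ₖ (1 : Matrix R R ℂ))ᴴ) (b, r) (b', r') =
      (U * Matrix.of (fun a a' => ρ (a, r) (a', r')) * Uᴴ) b b' := by
  simp [Matrix.mul_apply, Fintype.sum_prod_type, Matrix.one_apply, apply_ite]

theorem ampliate_channel₁_apply {R : Type} [Fintype R] [DecidableEq R]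
    (U : Matrix.unitaryGroup (Fin d) ℂ) (ρ : Matrix (Fin d × R) (Fin d × R) ℂ)
    (b c b' c' : Fin d) (r r' : R) :
    ampliate R (channel₁ d U) ρ ((b, c), r) ((b', c'), r') =
      (d : ℂ)⁻¹ * (((U : Matrix (Fin d) (Fin d) ℂ) ⊗ₖ (1 : Matrix R R ℂ)) * ρ *
        ((U : Matrix (Fin d) (Fin d) ℂ) ⊗ₖ (1 : Matrix R R ℂ))ᴴ) (b, r) (b', r') *
        (1 : Matrix (Fin d) (Fin d) ℂ) c c' := by
  rw [kronecker_one_conj_apply]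
  simp only [ampliate, channel₁, LinearMap.coe_mk, AddHom.coe_mk, of_apply, kroneckerMap_apply,
    Matrix.smul_apply, smul_eq_mul]
  ring

theorem ampliate_channel₂_apply {R : Type} [Fintype R] [DecidableEq R]
    (U : Matrix.unitaryGroup (Fin d) ℂ) (ρ : Matrix (Fin d × R) (Fin d × R) ℂ)
    (b c b' c' : Fin d) (r r' : R) :
    ampliate R (channel₂ d U) ρ ((b, c), r) ((b', c'), r') =
      (d : ℂ)⁻¹ * (((U : Matrix (Fin d) (Fin d) ℂ) ⊗ₖ (1 : Matrix R R ℂ)) * ρ *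
        ((U : Matrix (Fin d) (Fin d) ℂ) ⊗ₖ (1 : Matrix R R ℂ))ᴴ) (c, r) (c', r') *
        (1 : Matrix (Fin d) (Fin d) ℂ) b b' := by
  rw [kronecker_one_conj_apply]
  simp only [ampliate, channel₂, LinearMap.coe_mk, AddHom.coe_mk, of_apply, kroneckerMap_apply,
    Matrix.smul_apply, smul_eq_mul]
  ring

theorem trace_channel₁ (hd : 1 ≤ d) (U : Matrix.unitaryGroup (Fin d) ℂ)
    (ρ : Matrix (Fin d) (Fin d) ℂ) : (channel₁ d U ρ).trace = ρ.trace := by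
  have : (d : ℂ) ≠ 0 := by exact_mod_cast (by omega : d ≠ 0)
  have hU : (U : Matrix (Fin d) (Fin d) ℂ)ᴴ * U = 1 := Matrix.UnitaryGroup.star_mul_self U
  simp [channel₁, trace_kronecker, trace_mul_comm _ (U : Matrix (Fin d) (Fin d) ℂ)ᴴ,
    ← Matrix.mul_assoc, hU, this]

theorem trace_channel₂ (hd : 1 ≤ d) (U : Matrix.unitaryGroup (Fin d) ℂ)
    (ρ : Matrix (Fin d) (Fin d) ℂ) : (channel₂ d U ρ).trace = ρ.trace := by
  have : (d : ℂ) ≠ 0 := by exact_mod_cast (by omega : d ≠ 0)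
  have hU : (U : Matrix (Fin d) (Fin d) ℂ)ᴴ * U = 1 := Matrix.UnitaryGroup.star_mul_self U
  simp [channel₂, trace_kronecker, trace_mul_comm _ (U : Matrix (Fin d) (Fin d) ℂ)ᴴ,
    ← Matrix.mul_assoc, hU, this]

theorem natCast_inv_nonneg (d : ℕ) : (0 : ℂ) ≤ (d : ℂ)⁻¹ := by
  rw [← Complex.ofReal_natCast, ← Complex.ofReal_inv]
  exact_mod_cast (by positivity : (0 : ℝ) ≤ (d : ℝ)⁻¹)

/-- One query maps the off-diagonal block to a block with trace divided by `d`. -/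
theorem exists_fromBlocks_ampliate {R : Type} [Fintype R]
    (U : Matrix.unitaryGroup (Fin d) ℂ) {ρ X Y σ : Matrix (Fin d × R) (Fin d × R) ℂ}
    (h : (fromBlocks ρ X Y σ).PosSemidef) :
    ∃ X' Y' : Matrix ((Fin d × Fin d) × R) ((Fin d × Fin d) × R) ℂ,
      (fromBlocks (ampliate R (channel₁ d U) ρ) X' Y' (ampliate R (channel₂ d U) σ)).PosSemidef ∧
      X'.trace = (d : ℂ)⁻¹ * X.trace := by
  classical
  set V := (U : Matrix (Fin d) (Fin d) ℂ) ⊗ₖ (1 : Matrix R R ℂ) with hV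
  have hVV : Vᴴ * V = 1 := by
    rw [hV, conjTranspose_kronecker, ← mul_kronecker_mul, conjTranspose_one, mul_one]
    have : (U : Matrix (Fin d) (Fin d) ℂ)ᴴ * U = 1 := Matrix.UnitaryGroup.star_mul_self U
    rw [this, one_kronecker_one]
  -- `g` selects the output carrying the rotated state, `s` the maximally mixed one. The roles of
  -- the two outputs are swapped between the two halves.
  let g : ((Fin d × Fin d) × R) ⊕ ((Fin d × Fin d) × R) → (Fin d × R) ⊕ (Fin d × R) :=
    Sum.elim (fun x => Sum.inl (x.1.1, x.2)) fun x => Sum.inr (x.1.2, x.2)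
  let s : ((Fin d × Fin d) × R) ⊕ ((Fin d × Fin d) × R) → Fin d :=
    Sum.elim (fun x => x.1.2) fun x => x.1.1
  set M := (d : ℂ)⁻¹ • (((fromBlocks (V * ρ * Vᴴ) (V * X * Vᴴ) (V * Y * Vᴴ)
    (V * σ * Vᴴ)).submatrix g g) ⊙ ((1 : Matrix (Fin d) (Fin d) ℂ).submatrix s s)) with hM
  have hMpos : M.PosSemidef :=
    (((h.fromBlocks_conj V V).submatrix g).hadamard (PosSemidef.one.submatrix s)).smul
      (natCast_inv_nonneg d)
  refine ⟨M.toBlocks₁₂, M.toBlocks₂₁, ?_, ?_⟩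
  · convert hMpos using 1
    rw [← fromBlocks_toBlocks M]
    congr 1
    · ext ⟨⟨b, c⟩, r⟩ ⟨⟨b', c'⟩, r'⟩
      rw [ampliate_channel₁_apply, mul_assoc]
      rfl
    · ext ⟨⟨b, c⟩, r⟩ ⟨⟨b', c'⟩, r'⟩
      rw [ampliate_channel₂_apply, mul_assoc]
      rfl
  · have : X.trace = (V * X * Vᴴ).trace := by
      rw [trace_mul_comm, ← Matrix.mul_assoc, hVV, Matrix.one_mul]
    rw [this]
    simp only [Matrix.trace, Fintype.sum_prod_type, diag_apply, Finset.mul_sum]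
    refine Finset.sum_congr rfl fun b _ => ?_
    -- On the diagonal of the corner the mask is the delta of `b` and `c`; the surviving terms form
    -- the trace of `V * X * Vᴴ`.
    rw [Finset.sum_eq_single b]
    · refine Finset.sum_congr rfl fun r _ => ?_
      have : (1 : Matrix (Fin d) (Fin d) ℂ) (s (Sum.inl ((b, b), r))) (s (Sum.inr ((b, b), r))) =
        1 := Matrix.one_apply_eq b
      simp [hM, toBlocks₁₂, g, this]
    · intro c _ hcb
      refine Finset.sum_eq_zero fun r _ => ?_
      have : s (Sum.inl ((b, c), r)) ≠ s (Sum.inr ((b, c), r)) := hcb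
      simp [hM, toBlocks₁₂, g, Matrix.one_apply_ne this]
    · simp

end Intermediary

/-! ### Error bounds for sequential strategies -/

section Strategies

variable {d N : ℕ}

theorem exists_fromBlocks_stateBefore (S : IntermediaryStrategy d N)
    (U : Matrix.unitaryGroup (Fin d) ℂ) (t : ℕ) :
    ∃ X Y, (fromBlocks (S.stateBefore (channel₁ d U) t) X Y
      (S.stateBefore (channel₂ d U) t)).PosSemidef ∧ X.trace = ((d : ℂ)⁻¹) ^ t := by
  induction t with
  | zero =>
    refine ⟨S.init, S.init, ?_, by simpa using S.init_isDensity.2⟩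
    have h := S.init_isDensity.1.submatrix (Sum.elim id id)
    convert h using 1
    ext (i | i) (j | j) <;> rfl
  | succ t ih =>
    obtain ⟨X, Y, h, hX⟩ := ih
    obtain ⟨X', Y', h', hX'⟩ := exists_fromBlocks_ampliate U h
    refine ⟨_, _, (S.step_isChannel t).posSemidef_fromBlocks h', ?_⟩
    rw [(S.step_isChannel t).2, hX', hX, pow_succ']

theorem exists_fromBlocks_finalState (hN : 1 ≤ N) (S : IntermediaryStrategy d N)
    (U : Matrix.unitaryGroup (Fin d) ℂ) :
    ∃ X Y, (fromBlocks (S.finalState (channel₁ d U)) X Y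
      (S.finalState (channel₂ d U))).PosSemidef ∧ X.trace = ((d : ℂ)⁻¹) ^ N := by
  obtain ⟨X, Y, h, hX⟩ := exists_fromBlocks_stateBefore S U (N - 1)
  obtain ⟨X', Y', h', hX'⟩ := exists_fromBlocks_ampliate U h
  refine ⟨X', Y', h', ?_⟩
  rw [hX', hX, ← pow_succ', Nat.sub_add_cancel hN]

theorem trace_finalState {A B : Type} [Fintype A] [Fintype B] [DecidableEq B]
    (S : SequentialStrategy A B N)
    {C : Matrix A A ℂ →ₗ[ℂ] Matrix B B ℂ} (hC : ∀ ρ, (C ρ).trace = ρ.trace) :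
    (S.finalState C).trace = 1 := by
  have : ∀ t, (S.stateBefore C t).trace = 1 := by
    intro t
    induction t with
    | zero => exact S.init_isDensity.2
    | succ t ih =>
      rw [SequentialStrategy.stateBefore, (S.step_isChannel t).2, trace_ampliate hC, ih]
  rw [SequentialStrategy.finalState, trace_ampliate hC, this]

theorem le_errorProb (hd : 1 ≤ d) (hN : 1 ≤ N) (S : IntermediaryStrategy d N)
    (U : Matrix.unitaryGroup (Fin d) ℂ) :
    1 / (4 * (d : ℝ) ^ (2 * N)) ≤ S.errorProb (channel₁ d U) (channel₂ d U) := by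
  obtain ⟨X, Y, h, hX⟩ := exists_fromBlocks_finalState hN S U
  have := sq_re_trace_le_error h (trace_finalState S (trace_channel₁ hd U))
    (trace_finalState S (trace_channel₂ hd U)) S.guess₁_posSemidef S.guess₂_posSemidef S.guess_add
  refine le_trans (le_of_eq ?_) this
  have hX' : X.trace = (((d : ℝ)⁻¹ ^ N : ℝ) : ℂ) := by rw [hX]; push_cast; rfl
  rw [hX', Complex.ofReal_re, pow_mul', inv_pow, inv_pow, one_div, mul_inv]
  ring

theorem posSemidef_finalState (S : IntermediaryStrategy d N) (U : Matrix.unitaryGroup (Fin d) ℂ) :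
    (S.finalState (channel₁ d U)).PosSemidef ∧ (S.finalState (channel₂ d U)).PosSemidef := by
  obtain ⟨X, Y, h, -⟩ := exists_fromBlocks_stateBefore S U (N - 1)
  obtain ⟨X', Y', h', -⟩ := exists_fromBlocks_ampliate U h
  exact h'.fromBlocks_diag

/-- Supplies the upper bound without which the real supremum over gates would not dominate its
members. -/
theorem errorProb_le_one (hd : 1 ≤ d) (S : IntermediaryStrategy d N)
    (U V : Matrix.unitaryGroup (Fin d) ℂ) : S.errorProb (channel₁ d U) (channel₂ d V) ≤ 1 := by
  have h1 := (Complex.le_def.mp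
    (S.guess₁_posSemidef.trace_mul_nonneg (posSemidef_finalState S U).1)).1
  have h2 := (Complex.le_def.mp
    (S.guess₂_posSemidef.trace_mul_nonneg (posSemidef_finalState S V).2)).1
  have h3 : ∀ M, (S.guess₁ * M).trace.re + (S.guess₂ * M).trace.re = M.trace.re := by
    intro M
    rw [← Complex.add_re, ← trace_add, ← add_mul, S.guess_add, one_mul]
  have h4 := h3 (S.finalState (channel₁ d U))
  have h5 := h3 (S.finalState (channel₂ d V))
  rw [trace_finalState S (trace_channel₁ hd U), Complex.one_re] at h4
  rw [trace_finalState S (trace_channel₂ hd V), Complex.one_re] at h5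
  rw [Complex.zero_re] at h1 h2
  rw [SequentialStrategy.errorProb]
  linarith

theorem le_worstCaseError (hd : 1 ≤ d) (hN : 1 ≤ N) (S : IntermediaryStrategy d N) :
    1 / (4 * (d : ℝ) ^ (2 * N)) ≤ worstCaseError S := by
  refine (le_errorProb hd hN S 1).trans ?_
  exact le_ciSup (f := fun p : Matrix.unitaryGroup (Fin d) ℂ × Matrix.unitaryGroup (Fin d) ℂ =>
    S.errorProb (channel₁ d p.1) (channel₂ d p.2))
    ⟨1, by rintro _ ⟨p, rfl⟩; exact errorProb_le_one hd S p.1 p.2⟩ (1, 1)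

/-- The channel that discards its input and prepares the basis state `a`. -/
noncomputable def prepare {A B : Type} [Fintype B] [DecidableEq A] (a : A) :
    Matrix B B ℂ →ₗ[ℂ] Matrix A A ℂ where
  toFun ρ := ρ.trace • Matrix.single a a 1
  map_add' ρ σ := by rw [trace_add, add_smul]
  map_smul' c ρ := by rw [trace_smul, smul_assoc, RingHom.id_apply]

theorem isChannel_prepare {A B : Type} [Fintype A] [Fintype B] [DecidableEq A] (a : A) :
    IsChannel (prepare a : Matrix B B ℂ →ₗ[ℂ] Matrix A A ℂ) := by
  refine ⟨fun r ρ hρ => ?_, fun ρ => by simp [prepare]⟩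
  have h1 : (∑ b : B, ρ.submatrix (fun x : A × Fin r => (b, x.2))
      fun x : A × Fin r => (b, x.2)).PosSemidef :=
    posSemidef_sum _ fun b _ => hρ.submatrix _
  have h2 : (Matrix.single a a (1 : ℂ)).PosSemidef := by
    refine PosSemidef.of_mul_self_eq ?_ (by simp)
    rw [IsHermitian, conjTranspose_single, star_one]
  have h3 := h1.hadamard (h2.submatrix fun x : A × Fin r => x.1)
  refine (congrArg Matrix.PosSemidef ?_).mpr h3
  ext i j
  simp [ampliate, prepare, Matrix.trace, Matrix.sum_apply, Matrix.single_apply]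

/-- The real infimum over an empty family is `0`, so the lower bounds on infima need at least one
strategy. -/
instance {A B : Type} [Fintype A] [DecidableEq A] [Nonempty A] [Fintype B] [DecidableEq B] :
    Nonempty (SequentialStrategy A B N) := by
  obtain ⟨a⟩ := ‹Nonempty A›
  refine ⟨{
    mem := fun _ => 1
    init := Matrix.single (a, 0) (a, 0) 1
    init_isDensity := ⟨?_, by simp⟩
    step := fun _ => prepare (a, 0)
    step_isChannel := fun _ => isChannel_prepare _
    guess₁ := 1
    guess₂ := 0
    guess₁_posSemidef := PosSemidef.one
    guess₂_posSemidef := PosSemidef.zero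
    guess_add := add_zero 1 }⟩
  refine PosSemidef.of_mul_self_eq ?_ (by simp)
  rw [IsHermitian, conjTranspose_single, star_one]

/-- The factor `4` costs only `2/N` in the exponent, which vanishes in the limit. -/
theorem discriminationRate_le (hd : 1 ≤ d) {p : ℕ → ℝ}
    (hp : ∀ N, 1 ≤ N → 1 / (4 * (d : ℝ) ^ (2 * N)) ≤ p N) :
    discriminationRate p ≤ ((2 * Real.logb 2 d : ℝ) : EReal) := by
  have hd' : (0 : ℝ) < d := by exact_mod_cast hd
  have hlim : Filter.Tendsto (fun N : ℕ => ((2 / (N : ℝ) + 2 * Real.logb 2 d : ℝ) : EReal))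
      Filter.atTop (nhds ((2 * Real.logb 2 d : ℝ) : EReal)) := by
    refine (continuous_coe_real_ereal.tendsto _).comp ?_
    simpa using (tendsto_const_div_atTop_nhds_zero_nat (2 : ℝ)).add_const (2 * Real.logb 2 (d : ℝ))
  rw [discriminationRate, ← hlim.limsup_eq]
  refine Filter.limsup_le_limsup ?_
  filter_upwards [Filter.eventually_ge_atTop 1] with N hN
  have hN' : (0 : ℝ) < N := by exact_mod_cast hN
  rw [EReal.coe_le_coe_iff, div_le_iff₀ hN', add_mul, div_mul_cancel₀ _ hN'.ne']
  have h := Real.logb_le_logb_of_le (b := 2) (by norm_num) (by positivity) (hp N hN)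
  have h4 : Real.logb 2 4 = 2 := by
    rw [show (4 : ℝ) = 2 ^ (2 : ℕ) by norm_num, Real.logb_pow, Real.logb_self_eq_one (by norm_num)]
    norm_num
  rw [one_div, Real.logb_inv, Real.logb_mul (by norm_num) (by positivity), Real.logb_pow, h4] at h
  push_cast at h
  linarith

end Strategies

/-! ### The fidelity divergence and its attainment -/

section Divergence

variable {d : ℕ}

/-- The maximally entangled state whose input part is rotated by `U†`. -/
noncomputable def entangledState (U : Matrix.unitaryGroup (Fin d) ℂ) :
    Matrix (Fin d × Fin d) (Fin d × Fin d) ℂ :=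
  (d : ℂ)⁻¹ • vecMulVec (fun x => star ((U : Matrix (Fin d) (Fin d) ℂ) x.2 x.1))
    (fun x => (U : Matrix (Fin d) (Fin d) ℂ) x.2 x.1)

theorem sum_star_mul_unitary (U : Matrix.unitaryGroup (Fin d) ℂ) :
    ∑ x : Fin d × Fin d, (U : Matrix (Fin d) (Fin d) ℂ) x.2 x.1 *
      star ((U : Matrix (Fin d) (Fin d) ℂ) x.2 x.1) = d := by
  have hU : (U : Matrix (Fin d) (Fin d) ℂ) * (U : Matrix (Fin d) (Fin d) ℂ)ᴴ = 1 :=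
    mem_unitaryGroup_iff.mp U.2
  have := congrArg Matrix.trace hU
  rw [trace_one, Fintype.card_fin] at this
  rw [← this, Fintype.sum_prod_type_right]
  simp [Matrix.trace, Matrix.mul_apply]

theorem isDensity_entangledState (hd : 1 ≤ d) (U : Matrix.unitaryGroup (Fin d) ℂ) :
    IsDensity (entangledState U) := by
  have hd0 : (d : ℂ) ≠ 0 := by exact_mod_cast (by omega : d ≠ 0)
  refine ⟨PosSemidef.smul ?_ (natCast_inv_nonneg d), ?_⟩
  · exact posSemidef_vecMulVec_star_self
      (fun x : Fin d × Fin d => (U : Matrix (Fin d) (Fin d) ℂ) x.2 x.1)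
  · rw [entangledState, trace_smul, trace_vecMulVec, dotProduct_comm, dotProduct,
      sum_star_mul_unitary, smul_eq_mul, inv_mul_cancel₀ hd0]

theorem entangledState_mul_self (hd : 1 ≤ d) (U : Matrix.unitaryGroup (Fin d) ℂ) :
    entangledState U * entangledState U = entangledState U := by
  have hd0 : (d : ℂ) ≠ 0 := by exact_mod_cast (by omega : d ≠ 0)
  rw [entangledState, Matrix.smul_mul, Matrix.mul_smul, vecMulVec_mul_vecMulVec, dotProduct,
    sum_star_mul_unitary, vecMulVec_smul, smul_smul (d : ℂ)⁻¹ (d : ℂ), inv_mul_cancel₀ hd0,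
    one_smul]

theorem fidelity_self_of_mul_self_eq {A : Type} [Fintype A] [DecidableEq A] {ρ : Matrix A A ℂ}
    (hρ : IsDensity ρ) (h : ρ * ρ = ρ) : fidelity ρ ρ = 1 := by
  have hs : CFC.sqrt ρ = ρ := CFC.sqrt_unique h hρ.1.nonneg
  rw [fidelity, hs, h, h, hs, hρ.2]
  simp

/-- `W * Wᴴ` squares to `k` times itself, so its square roots are again multiples of it. -/
theorem sqrt_smul_mul_conjTranspose {m n : Type} [Fintype m] [DecidableEq m] [Fintype n]
    [DecidableEq n] {W : Matrix m n ℂ} {k a c : ℝ} (hW : Wᴴ * W = (k : ℂ) • 1)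
    (hc : 0 ≤ c) (ha : c ^ 2 * k = a) :
    CFC.sqrt ((a : ℂ) • (W * Wᴴ)) = (c : ℂ) • (W * Wᴴ) := by
  have hc' : (0 : ℂ) ≤ c := by exact_mod_cast hc
  refine CFC.sqrt_unique ?_ ((posSemidef_self_mul_conjTranspose W).smul hc').nonneg
  rw [Matrix.smul_mul, Matrix.mul_smul, Matrix.mul_assoc, ← Matrix.mul_assoc Wᴴ, hW,
    Matrix.smul_mul, Matrix.one_mul, Matrix.mul_smul, smul_smul, smul_smul, ← ha]
  push_cast
  ring_nf

/-- Since `Wᴴ * Z = 1`, the product inside the fidelity collapses to `d⁻⁵ W Wᴴ`. Its root `d⁻³ W Wᴴ`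
has trace `d⁻³ · d² = d⁻¹`. -/
theorem fidelity_smul_mul_conjTranspose {m : Type} [Fintype m] [DecidableEq m]
    (hd : 1 ≤ d) {W Z : Matrix m (Fin d) ℂ} (hW : Wᴴ * W = ((d : ℝ) : ℂ) • 1)
    (hWZ : Wᴴ * Z = 1) :
    fidelity ((((d : ℝ)⁻¹ ^ 2 : ℝ) : ℂ) • (W * Wᴴ)) ((((d : ℝ)⁻¹ ^ 2 : ℝ) : ℂ) • (Z * Zᴴ)) =
      1 / (d : ℝ) ^ 2 := by
  have hd0 : (0 : ℝ) < d := by exact_mod_cast hd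
  have hq : (Real.sqrt d)⁻¹ ^ 2 = (d : ℝ)⁻¹ := by rw [inv_pow, Real.sq_sqrt hd0.le]
  have hZW : Zᴴ * W = 1 := by
    rw [← conjTranspose_conjTranspose W, ← conjTranspose_mul, hWZ, conjTranspose_one]
  have h1 := sqrt_smul_mul_conjTranspose (a := (d : ℝ)⁻¹ ^ 2) (c := (d : ℝ)⁻¹ * (Real.sqrt d)⁻¹) hW
    (by positivity) (by rw [mul_pow, hq]; field_simp)
  have h2 : (((d : ℝ)⁻¹ * (Real.sqrt d)⁻¹ : ℝ) : ℂ) • (W * Wᴴ) *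
      ((((d : ℝ)⁻¹ ^ 2 : ℝ) : ℂ) • (Z * Zᴴ)) *
      ((((d : ℝ)⁻¹ * (Real.sqrt d)⁻¹ : ℝ) : ℂ) • (W * Wᴴ)) =
      (((d : ℝ)⁻¹ ^ 5 : ℝ) : ℂ) • (W * Wᴴ) := by
    have : W * Wᴴ * (Z * Zᴴ) * (W * Wᴴ) = W * Wᴴ := by
      rw [Matrix.mul_assoc W, ← Matrix.mul_assoc Wᴴ Z, hWZ, Matrix.one_mul, Matrix.mul_assoc W,
        ← Matrix.mul_assoc Zᴴ, hZW, Matrix.one_mul]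
    simp only [Matrix.smul_mul, Matrix.mul_smul, smul_smul, this, ← Complex.ofReal_mul]
    congr 2
    linear_combination (d : ℝ)⁻¹ ^ 4 * hq
  have h3 := sqrt_smul_mul_conjTranspose (a := (d : ℝ)⁻¹ ^ 5) (c := (d : ℝ)⁻¹ ^ 3) hW
    (by positivity) (by field_simp)
  rw [fidelity, h1, h2, h3, trace_smul, trace_mul_comm, hW, trace_smul, trace_one,
    Fintype.card_fin, smul_eq_mul, smul_eq_mul, ← Complex.ofReal_natCast, ← Complex.ofReal_mul,
    ← Complex.ofReal_mul, Complex.ofReal_re]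
  field_simp

theorem conj_entangledState_block (U : Matrix.unitaryGroup (Fin d) ℂ) (r r' : Fin d) :
    (U : Matrix (Fin d) (Fin d) ℂ) *
      Matrix.of (fun a a' => entangledState U (a, r) (a', r')) *
      (U : Matrix (Fin d) (Fin d) ℂ)ᴴ = (d : ℂ)⁻¹ • Matrix.single r r' 1 := by
  have hU : (U : Matrix (Fin d) (Fin d) ℂ) * (U : Matrix (Fin d) (Fin d) ℂ)ᴴ = 1 :=
    mem_unitaryGroup_iff.mp U.2
  have : Matrix.of (fun a a' => entangledState U (a, r) (a', r')) = (d : ℂ)⁻¹ •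
      ((U : Matrix (Fin d) (Fin d) ℂ)ᴴ * Matrix.single r r' 1 * (U : Matrix _ _ ℂ)) := by
    ext a a'
    simp [entangledState, vecMulVec_apply, Matrix.mul_apply, Matrix.single_apply, ite_and]
  rw [this, Matrix.mul_smul, Matrix.smul_mul]
  congr 1
  calc _ = ((U : Matrix (Fin d) (Fin d) ℂ) * (U : Matrix (Fin d) (Fin d) ℂ)ᴴ) *
        Matrix.single r r' 1 *
        ((U : Matrix (Fin d) (Fin d) ℂ) * (U : Matrix (Fin d) (Fin d) ℂ)ᴴ) := by
        simp only [Matrix.mul_assoc]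
    _ = _ := by rw [hU, Matrix.one_mul, Matrix.mul_one]

theorem fidelity_ampliate_entangledState (hd : 1 ≤ d) (U : Matrix.unitaryGroup (Fin d) ℂ) :
    fidelity (ampliate (Fin d) (channel₁ d U) (entangledState U))
      (ampliate (Fin d) (channel₂ d U) (entangledState U)) = 1 / (d : ℝ) ^ 2 := by
  -- Column `k` of `W` is the unnormalized maximally entangled vector of the first output and the
  -- reference, with the second output in state `k`; `Z` exchanges the two outputs.
  let W : Matrix ((Fin d × Fin d) × Fin d) (Fin d) ℂ :=
    Matrix.of fun x k => if x.1.1 = x.2 ∧ x.1.2 = k then 1 else 0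
  let Z : Matrix ((Fin d × Fin d) × Fin d) (Fin d) ℂ :=
    Matrix.of fun x k => if x.1.2 = x.2 ∧ x.1.1 = k then 1 else 0
  have hW : Wᴴ * W = ((d : ℝ) : ℂ) • 1 := by
    ext k l
    by_cases h : l = k <;>
      simp [W, Matrix.mul_apply, Fintype.sum_prod_type, ite_and, h, Ne.symm]
  have hWZ : Wᴴ * Z = 1 := by
    ext k l
    by_cases h : l = k <;>
      simp [W, Z, Matrix.mul_apply, Fintype.sum_prod_type, Matrix.one_apply, ite_and, h,
        apply_ite (starRingEnd ℂ)] <;> grind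
  have h1 : ampliate (Fin d) (channel₁ d U) (entangledState U) =
      (((d : ℝ)⁻¹ ^ 2 : ℝ) : ℂ) • (W * Wᴴ) := by
    ext ⟨⟨b, c⟩, r⟩ ⟨⟨b', c'⟩, r'⟩
    rw [ampliate_channel₁_apply, kronecker_one_conj_apply, conj_entangledState_block]
    by_cases h1 : r = b <;> by_cases h2 : r' = b' <;> by_cases h3 : c = c' <;>
      simp [W, Matrix.mul_apply, Matrix.one_apply, ite_and, h1, h2, h3, pow_two] <;> grind
  have h2 : ampliate (Fin d) (channel₂ d U) (entangledState U) =
      (((d : ℝ)⁻¹ ^ 2 : ℝ) : ℂ) • (Z * Zᴴ) := by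
    ext ⟨⟨b, c⟩, r⟩ ⟨⟨b', c'⟩, r'⟩
    rw [ampliate_channel₂_apply, kronecker_one_conj_apply, conj_entangledState_block]
    by_cases h1 : r = c <;> by_cases h2 : r' = c' <;> by_cases h3 : b = b' <;>
      simp [Z, Matrix.mul_apply, Matrix.one_apply, ite_and, h1, h2, h3, pow_two] <;> grind
  rw [h1, h2, fidelity_smul_mul_conjTranspose hd hW hWZ]

theorem le_fidelity_ampliate {R : Type} [Fintype R] [DecidableEq R]
    (U : Matrix.unitaryGroup (Fin d) ℂ) {ρ σ : Matrix (Fin d × R) (Fin d × R) ℂ}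
    (hρ : ρ.PosSemidef) (hσ : σ.PosSemidef) :
    1 / (d : ℝ) ^ 2 * fidelity ρ σ ≤
      fidelity (ampliate R (channel₁ d U) ρ) (ampliate R (channel₂ d U) σ) := by
  obtain ⟨X, Y, h, hX⟩ := exists_trace_eq_rootFidelity hρ hσ
  obtain ⟨X', Y', h', hX'⟩ := exists_fromBlocks_ampliate U h
  have := re_trace_le_rootFidelity h'
  rw [hX', ← Complex.ofReal_natCast, ← Complex.ofReal_inv, Complex.re_ofReal_mul, hX] at this
  have h0 : 0 ≤ (d : ℝ)⁻¹ * rootFidelity ρ σ :=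
    mul_nonneg (by positivity) (rootFidelity_nonneg ρ σ)
  rw [fidelity_eq_sq, fidelity_eq_sq]
  calc 1 / (d : ℝ) ^ 2 * rootFidelity ρ σ ^ 2 = ((d : ℝ)⁻¹ * rootFidelity ρ σ) ^ 2 := by
        rw [mul_pow, inv_pow, one_div]
    _ ≤ _ := pow_le_pow_left₀ h0 this 2

theorem fidelityDivergence_channel (hd : 1 ≤ d) (U : Matrix.unitaryGroup (Fin d) ℂ) :
    fidelityDivergence (channel₁ d U) (channel₂ d U) = 1 / (d : ℝ) ^ 2 := by
  refine IsLeast.csInf_eq ⟨?_, ?_⟩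
  · have h := isDensity_entangledState hd U
    have h1 := fidelity_self_of_mul_self_eq h (entangledState_mul_self hd U)
    refine ⟨d, _, _, h, h, by rw [h1]; exact one_ne_zero, ?_⟩
    rw [h1, div_one, fidelity_ampliate_entangledState hd U]
  · rintro _ ⟨r, ρ, σ, hρ, hσ, hne, rfl⟩
    have hpos : 0 < fidelity ρ σ := lt_of_le_of_ne (sq_nonneg _) hne.symm
    rw [le_div_iff₀ hpos]
    exact le_fidelity_ampliate U hρ.1 hσ.1

end Divergence

end CausalId

theorem mainTheorem3 (d : ℕ) (hd : 1 ≤ d) :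
    -- the fidelity divergence
    (∀ U : Matrix.unitaryGroup (Fin d) ℂ,
      CausalId.fidelityDivergence (CausalId.channel₁ d U) (CausalId.channel₂ d U)
        = 1 / (d : ℝ) ^ 2) ∧
    -- the error in distinguishing the two channels for a fixed gate
    (∀ (U : Matrix.unitaryGroup (Fin d) ℂ) (N : ℕ), 1 ≤ N →
      (∀ S : CausalId.IntermediaryStrategy d N,
        1 / (4 * (d : ℝ) ^ (2 * N)) ≤
          S.errorProb (CausalId.channel₁ d U) (CausalId.channel₂ d U)) ∧
      1 / (4 * (d : ℝ) ^ (2 * N)) ≤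
        CausalId.seqErrorProb (CausalId.channel₁ d U) (CausalId.channel₂ d U) N) ∧
    -- the worst-case error in identifying the causal intermediary
    (∀ N : ℕ, 1 ≤ N →
      (∀ S : CausalId.IntermediaryStrategy d N,
        1 / (4 * (d : ℝ) ^ (2 * N)) ≤ CausalId.worstCaseError S) ∧
      1 / (4 * (d : ℝ) ^ (2 * N)) ≤ CausalId.intermediaryError d N) ∧
    -- the rate, for every sequence of strategies and for the optimal ones
    (∀ S : (N : ℕ) → CausalId.IntermediaryStrategy d N,
      CausalId.discriminationRate (fun N => CausalId.worstCaseError (S N)) ≤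
        ((2 * Real.logb 2 d : ℝ) : EReal)) ∧
    CausalId.discriminationRate (fun N => CausalId.intermediaryError d N) ≤
      ((2 * Real.logb 2 d : ℝ) : EReal) := by
  -- Makes `Fin d` nonempty, hence also the type of strategies, as `le_ciInf` requires.
  have : NeZero d := ⟨by omega⟩
  refine ⟨CausalId.fidelityDivergence_channel hd, fun U N hN => ⟨fun S =>
    CausalId.le_errorProb hd hN S U, le_ciInf fun S => CausalId.le_errorProb hd hN S U⟩,
    fun N hN => ⟨CausalId.le_worstCaseError hd hN, le_ciInf (CausalId.le_worstCaseError hd hN)⟩,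
    fun S => CausalId.discriminationRate_le hd fun N hN => CausalId.le_worstCaseError hd hN (S N),
    CausalId.discriminationRate_le hd fun N hN => le_ciInf (CausalId.le_worstCaseError hd hN)⟩
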